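/- Let $F$ be a field of characteristic $5$. Let $A(2)=F[x_1,x_2]/(x_1^5,x_2^5)$ and let $W(2)=\mathrm{Der}_F A(2)$, a free $A(2)$-module with basis $D_1=\partial/\partial x_1$, $D_2=\partial/\partial x_2$; put $\mathrm{div}(f_1D_1+f_2D_2)=D_1(f_1)+D_2(f_2)$. Let $\widetilde{W(2)}=\{\widetilde{D} : D\in W(2)\}$ be a copy of $W(2)$. The (restricted) Melikian algebra is the $F$-Lie algebra $$M=A(2)\oplus W(2)\oplus\widetilde{W(2)}$$ whose bracket extends the commutator bracket of $W(2)$ and is given, for $D,E\in W(2)$ and $f,g,f_i,g_i\in A(2)$, by $$[D,\widetilde{E}]=\widetilde{[D,E]}+2\,\mathrm{div}(D)\widetilde{E},\qquad [D,f]=D(f)-2\,\mathrm{div}(D)f,\qquad [f,\widetilde{E}]=fE,$$ $$[f_1\widetilde{D_1}+f_2\widetilde{D_2},\,g_1\widetilde{D_1}+g_2\widetilde{D_2}]=f_1g_2-f_2g_1,$$ $$[f,g]=2\,(gD_2(f)-fD_2(g))\widetilde{D_1}+2\,(fD_1(g)-gD_1(f))\widetilde{D_2}.$$ Then the first (Chevalley--Eilenberg)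 cohomology group of $M$ with coefficients in the adjoint representation vanishes, $$H^1(M,M)=0;$$ equivalently, every $F$-linear derivation $\delta$ of the Lie algebra $M$ is inner, that is, $\delta=[m,\cdot\,]$ for some $m\in M$. -/

import Mathlib

noncomputable section

namespace Melikian

/-- The ideal `(x₁⁵, x₂⁵)` of `F[x₁, x₂]`. -/
def truncIdeal (F : Type*) [Field F] : Ideal (MvPolynomial (Fin 2) F) :=
  Ideal.span (Set.range fun i : Fin 2 => (MvPolynomial.X i : MvPolynomial (Fin 2) F) ^ 5)

/-- The algebra `A(2) = F[x₁, x₂] / (x₁⁵, x₂⁵)` of truncated polynomials. -/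
def A (F : Type*) [Field F] : Type _ := MvPolynomial (Fin 2) F ⧸ truncIdeal F

instance (F : Type*) [Field F] : CommRing (A F) :=
  inferInstanceAs (CommRing (MvPolynomial (Fin 2) F ⧸ truncIdeal F))

instance (F : Type*) [Field F] : Algebra F (A F) :=
  inferInstanceAs (Algebra F (MvPolynomial (Fin 2) F ⧸ truncIdeal F))

/-- The quotient map `F[x₁, x₂] → A(2)`. -/
def mk (F : Type*) [Field F] : MvPolynomial (Fin 2) F →ₐ[F] A F :=
  Ideal.Quotient.mkₐ F (truncIdeal F)

theorem mk_surjective (F : Type*) [Field F] : Function.Surjective (mk F) :=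
  Ideal.Quotient.mkₐ_surjective F (truncIdeal F)

theorem mk_eq_zero (F : Type*) [Field F] (f : MvPolynomial (Fin 2) F) :
    mk F f = 0 ↔ f ∈ truncIdeal F :=
  Ideal.Quotient.eq_zero_iff_mem

/-- The Witt-Jacobson Lie algebra `W(2) = Der_F A(2)`; its bracket is the commutator. -/
abbrev W (F : Type*) [Field F] : Type _ := Derivation F (A F) (A F)

/-- The classes of the two variables in `A(2)` (the index runs through `0, 1`). -/
def x (F : Type*) [Field F] (i : Fin 2) : A F := mk F (MvPolynomial.X i)

theorem five_eq_zero (F : Type*) [Field F] [CharP F 5] : (5 : A F) = 0 := by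
  have h : ((5 : ℕ) : F) = 0 := CharP.cast_eq_zero F 5
  have h' := congrArg (algebraMap F (A F)) h
  rwa [map_natCast, map_zero] at h'

theorem pderiv_mem (F : Type*) [Field F] [CharP F 5] (i : Fin 2) (f : MvPolynomial (Fin 2) F)
    (hf : f ∈ truncIdeal F) : MvPolynomial.pderiv i f ∈ truncIdeal F := by
  have h5 : (5 : MvPolynomial (Fin 2) F) = 0 := by
    have h : ((5 : ℕ) : F) = 0 := CharP.cast_eq_zero F 5
    have h' := congrArg (algebraMap F (MvPolynomial (Fin 2) F)) h
    rwa [map_natCast, map_zero] at h'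
  unfold truncIdeal at hf
  induction hf using Submodule.span_induction with
  | mem y hy =>
    obtain ⟨j, rfl⟩ := hy
    simp [Derivation.leibniz_pow, h5]
  | zero => simp
  | add y z _ _ hy hz => rw [map_add]; exact add_mem hy hz
  | smul a y hy h =>
    rw [smul_eq_mul, Derivation.leibniz, smul_eq_mul, smul_eq_mul]
    exact add_mem (Ideal.mul_mem_left _ _ h) (Ideal.mul_mem_right _ _ hy)

/-- The partial derivatives `D₁ = ∂/∂x₁`, `D₂ = ∂/∂x₂` of `A(2)`, induced by those of `F[x₁, x₂]`
(the index runs through `0, 1`). -/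
def D (F : Type*) [Field F] [CharP F 5] (i : Fin 2) : W F :=
  Derivation.liftOfSurjective (mk_surjective F) (d := MvPolynomial.pderiv i)
    fun f hf => (mk_eq_zero F _).mpr (pderiv_mem F i f ((mk_eq_zero F f).mp hf))

theorem D_mk (F : Type*) [Field F] [CharP F 5] (i : Fin 2) (f : MvPolynomial (Fin 2) F) :
    D F i (mk F f) = mk F (MvPolynomial.pderiv i f) :=
  Derivation.liftOfSurjective_apply (mk_surjective F)
    (fun f hf => (mk_eq_zero F _).mpr (pderiv_mem F i f ((mk_eq_zero F f).mp hf))) f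

theorem D_x (F : Type*) [Field F] [CharP F 5] (i j : Fin 2) :
    D F i (x F j) = if i = j then 1 else 0 := by
  rw [x, D_mk, MvPolynomial.pderiv_X]
  by_cases h : i = j
  · subst h; simp
  · simp [h, Ne.symm h]

theorem W_ext (F : Type*) [Field F] {E E' : W F} (h : ∀ i, E (x F i) = E' (x F i)) : E = E' := by
  ext f
  obtain ⟨f, rfl⟩ := mk_surjective F f
  induction f using MvPolynomial.induction_on with
  | C a =>
    have : mk F (MvPolynomial.C a) = algebraMap F (A F) a := (mk F).commutes a
    rw [this, Derivation.map_algebraMap, Derivation.map_algebraMap]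
  | add p q hp hq => rw [map_add, map_add, map_add, hp, hq]
  | mul_X p i hp =>
    have hi := h i
    rw [x] at hi
    rw [map_mul, Derivation.leibniz, Derivation.leibniz, hp, hi]

/-- `D₁, D₂` generate `W(2)` over `A(2)`; the coordinates of `E` are `E(x₁), E(x₂)`. -/
theorem W_apply (F : Type*) [Field F] [CharP F 5] (E : W F) (f : A F) :
    E f = E (x F 0) * D F 0 f + E (x F 1) * D F 1 f := by
  have : E = E (x F 0) • D F 0 + E (x F 1) • D F 1 := by
    apply W_ext
    intro i
    fin_cases i <;> simp [D_x]
  exact DFunLike.congr_fun this f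

theorem D_comm (F : Type*) [Field F] [CharP F 5] (f : A F) :
    D F 1 (D F 0 f) = D F 0 (D F 1 f) := by
  have : ⁅D F 1, D F 0⁆ = 0 := by
    apply W_ext
    intro i
    fin_cases i <;> simp [D_x, Derivation.commutator_apply]
  have := DFunLike.congr_fun this f
  simpa [Derivation.commutator_apply, sub_eq_zero] using this

/-- The divergence `div(f₁D₁ + f₂D₂) = D₁(f₁) + D₂(f₂)`; the coordinates of `E = f₁D₁ + f₂D₂`
are `fᵢ = E(xᵢ)`. -/
def div (F : Type*) [Field F] [CharP F 5] (E : W F) : A F := D F 0 (E (x F 0)) + D F 1 (E (x F 1))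

/-- The underlying vector space `A(2) ⊕ W(2) ⊕ W(2)~` of the Melikian algebra, where `W(2)~` is a
copy of `W(2)`. The triple `⟨f, E, G⟩` stands for `f + E + G~`. -/
@[ext]
structure M (F : Type*) [Field F] where
  /-- The component in `A(2)`. -/
  fn : A F
  /-- The component in `W(2)`. -/
  vf : W F
  /-- The component in the copy of `W(2)`. -/
  tvf : W F

/-- The identification of `A(2) ⊕ W(2) ⊕ W(2)~` with the product, along which the vector space
structure is transported. -/
def M.equivProd (F : Type*) [Field F] : M F ≃ A F × W F × W F where
  toFun a := (a.fn, a.vf, a.tvf)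
  invFun p := ⟨p.1, p.2.1, p.2.2⟩
  left_inv _ := rfl
  right_inv _ := rfl

instance (F : Type*) [Field F] : AddCommGroup (M F) := (M.equivProd F).addCommGroup

instance (F : Type*) [Field F] : Module F (M F) := (M.equivProd F).module F

/-- The bracket of the Melikian algebra: the bilinear alternating extension of
`[E, E']` the commutator in `W(2)`,
`[E, G~] = [E, G]~ + 2 div(E) G~`,
`[E, f] = E(f) - 2 div(E) f`,
`[f₁D₁~ + f₂D₂~, g₁D₁~ + g₂D₂~] = f₁g₂ - f₂g₁`,
`[f, G~] = f G`,
`[f, g] = 2 (g D₂(f) - f D₂(g)) D₁~ + 2 (f D₁(g) - g D₁(f)) D₂~`. -/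
def bracket (F : Type*) [Field F] [CharP F 5] (a b : M F) : M F :=
  { fn := (a.vf b.fn - 2 * div F a.vf * b.fn) - (b.vf a.fn - 2 * div F b.vf * a.fn)
      + (a.tvf (x F 0) * b.tvf (x F 1) - a.tvf (x F 1) * b.tvf (x F 0))
    vf := ⁅a.vf, b.vf⁆ + a.fn • b.tvf - b.fn • a.tvf
    tvf := (⁅a.vf, b.tvf⁆ + (2 * div F a.vf) • b.tvf)
      - (⁅b.vf, a.tvf⁆ + (2 * div F b.vf) • a.tvf)
      + (2 * (b.fn * D F 1 a.fn - a.fn * D F 1 b.fn)) • D F 0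
      + (2 * (a.fn * D F 0 b.fn - b.fn * D F 0 a.fn)) • D F 1 }

theorem M_ext (F : Type*) [Field F] {a b : M F} (h₁ : a.fn = b.fn)
    (h₂ : ∀ i, a.vf (x F i) = b.vf (x F i)) (h₃ : ∀ i, a.tvf (x F i) = b.tvf (x F i)) : a = b :=
  M.ext h₁ (W_ext F h₂) (W_ext F h₃)

section BracketLaws

variable (F : Type*) [Field F]

theorem add_1 (a b : M F) : (a + b).fn = a.fn + b.fn := rfl
theorem add_2 (a b : M F) : (a + b).vf = a.vf + b.vf := rfl
theorem add_3 (a b : M F) : (a + b).tvf = a.tvf + b.tvf := rfl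
theorem zero_1 : (0 : M F).fn = 0 := rfl
theorem zero_2 : (0 : M F).vf = 0 := rfl
theorem zero_3 : (0 : M F).tvf = 0 := rfl
theorem smul_1 (c : F) (a : M F) : (c • a).fn = c • a.fn := rfl
theorem smul_2 (c : F) (a : M F) : (c • a).vf = c • a.vf := rfl
theorem smul_3 (c : F) (a : M F) : (c • a).tvf = c • a.tvf := rfl

variable [CharP F 5]

theorem D_two (i : Fin 2) : D F i 2 = 0 := by
  have := (D F i).map_natCast 2
  simpa using this

/-- The `A(2)`-component of the bracket, in coordinates. -/
theorem bracket_1 (a b : M F) : (bracket F a b).fn =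
    (a.vf (x F 0) * D F 0 b.fn + a.vf (x F 1) * D F 1 b.fn
      - 2 * (D F 0 (a.vf (x F 0)) + D F 1 (a.vf (x F 1))) * b.fn)
    - (b.vf (x F 0) * D F 0 a.fn + b.vf (x F 1) * D F 1 a.fn
      - 2 * (D F 0 (b.vf (x F 0)) + D F 1 (b.vf (x F 1))) * a.fn)
    + (a.tvf (x F 0) * b.tvf (x F 1) - a.tvf (x F 1) * b.tvf (x F 0)) := by
  rw [← W_apply F a.vf, ← W_apply F b.vf]
  rfl

/-- The `W(2)`-component of the bracket, in coordinates. -/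
theorem bracket_2 (a b : M F) (i : Fin 2) : (bracket F a b).vf (x F i) =
    (a.vf (x F 0) * D F 0 (b.vf (x F i)) + a.vf (x F 1) * D F 1 (b.vf (x F i)))
    - (b.vf (x F 0) * D F 0 (a.vf (x F i)) + b.vf (x F 1) * D F 1 (a.vf (x F i)))
    + a.fn * b.tvf (x F i) - b.fn * a.tvf (x F i) := by
  rw [← W_apply F a.vf, ← W_apply F b.vf]
  rfl

/-- The `W(2)~`-component of the bracket, in coordinates. -/
theorem bracket_3 (a b : M F) (i : Fin 2) : (bracket F a b).tvf (x F i) =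
    (a.vf (x F 0) * D F 0 (b.tvf (x F i)) + a.vf (x F 1) * D F 1 (b.tvf (x F i))
      - (b.tvf (x F 0) * D F 0 (a.vf (x F i)) + b.tvf (x F 1) * D F 1 (a.vf (x F i)))
      + 2 * (D F 0 (a.vf (x F 0)) + D F 1 (a.vf (x F 1))) * b.tvf (x F i))
    - (b.vf (x F 0) * D F 0 (a.tvf (x F i)) + b.vf (x F 1) * D F 1 (a.tvf (x F i))
      - (a.tvf (x F 0) * D F 0 (b.vf (x F i)) + a.tvf (x F 1) * D F 1 (b.vf (x F i)))
      + 2 * (D F 0 (b.vf (x F 0)) + D F 1 (b.vf (x F 1))) * a.tvf (x F i))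
    + 2 * (b.fn * D F 1 a.fn - a.fn * D F 1 b.fn) * D F 0 (x F i)
    + 2 * (a.fn * D F 0 b.fn - b.fn * D F 0 a.fn) * D F 1 (x F i) := by
  rw [← W_apply F a.vf, ← W_apply F b.vf, ← W_apply F a.tvf, ← W_apply F b.tvf]
  rfl

set_option maxHeartbeats 4000000 in
theorem jacobi_1 (a b c : M F) : (bracket F a (bracket F b c)).fn -
    ((bracket F (bracket F a b) c).fn + (bracket F b (bracket F a c)).fn) = 0 := by
  have h5 := five_eq_zero F
  have h10 : (10 : A F) = 0 := by linear_combination 2 * h5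
  have h15 : (15 : A F) = 0 := by linear_combination 3 * h5
  have h20 : (20 : A F) = 0 := by linear_combination 4 * h5
  simp only [bracket_1, bracket_2, bracket_3, D_x, map_add, map_sub, Derivation.leibniz, D_two,
    smul_eq_mul, D_comm, zero_ne_one, one_ne_zero, if_true, if_false, map_zero, mul_zero,
    zero_mul, add_zero, zero_add, sub_zero, Derivation.map_one_eq_zero, mul_one]
  ring_nf
  try simp only [h5, h10, h15, h20, mul_zero, add_zero, sub_zero, zero_add, neg_zero]

set_option maxHeartbeats 4000000 in
theorem jacobi_2 (a b c : M F) (i : Fin 2) : (bracket F a (bracket F b c)).vf (x F i) -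
    ((bracket F (bracket F a b) c).vf (x F i) + (bracket F b (bracket F a c)).vf (x F i)) = 0 := by
  have h5 := five_eq_zero F
  have h10 : (10 : A F) = 0 := by linear_combination 2 * h5
  have h15 : (15 : A F) = 0 := by linear_combination 3 * h5
  have h20 : (20 : A F) = 0 := by linear_combination 4 * h5
  obtain rfl | rfl : i = 0 ∨ i = 1 := by omega
  · simp only [bracket_1, bracket_2, bracket_3, D_x, map_add, map_sub, Derivation.leibniz, D_two,
      smul_eq_mul, D_comm, zero_ne_one, one_ne_zero, if_true, if_false, map_zero, mul_zero,
      zero_mul, add_zero, zero_add, sub_zero, Derivation.map_one_eq_zero, mul_one]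
    ring_nf
    try simp only [h5, h10, h15, h20, mul_zero, add_zero, sub_zero, zero_add, neg_zero]
  · simp only [bracket_1, bracket_2, bracket_3, D_x, map_add, map_sub, Derivation.leibniz, D_two,
      smul_eq_mul, D_comm, zero_ne_one, one_ne_zero, if_true, if_false, map_zero, mul_zero,
      zero_mul, add_zero, zero_add, sub_zero, Derivation.map_one_eq_zero, mul_one]
    ring_nf
    try simp only [h5, h10, h15, h20, mul_zero, add_zero, sub_zero, zero_add, neg_zero]

set_option maxHeartbeats 4000000 in
theorem jacobi_3 (a b c : M F) (i : Fin 2) : (bracket F a (bracket F b c)).tvf (x F i) -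
    ((bracket F (bracket F a b) c).tvf (x F i) + (bracket F b (bracket F a c)).tvf (x F i)) = 0 := by
  have h5 := five_eq_zero F
  have h10 : (10 : A F) = 0 := by linear_combination 2 * h5
  have h15 : (15 : A F) = 0 := by linear_combination 3 * h5
  have h20 : (20 : A F) = 0 := by linear_combination 4 * h5
  obtain rfl | rfl : i = 0 ∨ i = 1 := by omega
  · simp only [bracket_1, bracket_2, bracket_3, D_x, map_add, map_sub, Derivation.leibniz, D_two,
      smul_eq_mul, D_comm, zero_ne_one, one_ne_zero, if_true, if_false, map_zero, mul_zero,
      zero_mul, add_zero, zero_add, sub_zero, Derivation.map_one_eq_zero, mul_one]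
    ring_nf
    try simp only [h5, h10, h15, h20, mul_zero, add_zero, sub_zero, zero_add, neg_zero]
  · simp only [bracket_1, bracket_2, bracket_3, D_x, map_add, map_sub, Derivation.leibniz, D_two,
      smul_eq_mul, D_comm, zero_ne_one, one_ne_zero, if_true, if_false, map_zero, mul_zero,
      zero_mul, add_zero, zero_add, sub_zero, Derivation.map_one_eq_zero, mul_one]
    ring_nf
    try simp only [h5, h10, h15, h20, mul_zero, add_zero, sub_zero, zero_add, neg_zero]

theorem bracket_add_left (a b c : M F) :
    bracket F (a + b) c = bracket F a c + bracket F b c := by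
  apply M_ext
  · simp only [bracket_1, add_1, add_2, add_3, Derivation.add_apply, map_add]; ring
  · intro i
    simp only [bracket_2, add_1, add_2, add_3, Derivation.add_apply, map_add]; ring
  · intro i
    simp only [bracket_3, add_1, add_2, add_3, Derivation.add_apply, map_add]; ring

theorem bracket_add_right (a b c : M F) :
    bracket F a (b + c) = bracket F a b + bracket F a c := by
  apply M_ext
  · simp only [bracket_1, add_1, add_2, add_3, Derivation.add_apply, map_add]; ring
  · intro i
    simp only [bracket_2, add_1, add_2, add_3, Derivation.add_apply, map_add]; ring
  · intro i
    simp only [bracket_3, add_1, add_2, add_3, Derivation.add_apply, map_add]; ring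

theorem bracket_self (a : M F) : bracket F a a = 0 := by
  apply M_ext
  · rw [bracket_1, zero_1]; ring
  · intro i; rw [bracket_2, zero_2, Derivation.zero_apply]; ring
  · intro i; rw [bracket_3, zero_3, Derivation.zero_apply]; ring

theorem bracket_smul (t : F) (a b : M F) : bracket F a (t • b) = t • bracket F a b := by
  apply M_ext
  · simp only [bracket_1, smul_1, smul_2, smul_3, Derivation.smul_apply, map_smul, Algebra.smul_def,
      Derivation.leibniz, Derivation.map_algebraMap, smul_eq_mul,
      Algebra.algebraMap_self, RingHom.id_apply]
    ring
  · intro i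
    simp only [bracket_2, smul_1, smul_2, smul_3, Derivation.smul_apply, map_smul, Algebra.smul_def,
      Derivation.leibniz, Derivation.map_algebraMap, smul_eq_mul,
      Algebra.algebraMap_self, RingHom.id_apply]
    ring
  · intro i
    simp only [bracket_3, smul_1, smul_2, smul_3, Derivation.smul_apply, map_smul, Algebra.smul_def,
      Derivation.leibniz, Derivation.map_algebraMap, smul_eq_mul,
      Algebra.algebraMap_self, RingHom.id_apply]
    ring

theorem jacobi (a b c : M F) : bracket F a (bracket F b c) =
    bracket F (bracket F a b) c + bracket F b (bracket F a c) :=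
  M_ext F (sub_eq_zero.mp (jacobi_1 F a b c)) (fun i => sub_eq_zero.mp (jacobi_2 F a b c i))
    (fun i => sub_eq_zero.mp (jacobi_3 F a b c i))

/-- The restricted Melikian algebra as a Lie algebra over `F`. -/
instance : LieRing (M F) where
  bracket := bracket F
  add_lie := bracket_add_left F
  lie_add := bracket_add_right F
  lie_self := bracket_self F
  leibniz_lie := jacobi F

instance : LieAlgebra F (M F) where
  lie_smul := bracket_smul F

end BracketLaws

section Cohomology

variable (R L V : Type*) [CommRing R] [LieRing L] [LieAlgebra R L]
  [AddCommGroup V] [Module R V] [LieRingModule L V] [LieModule R L V]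

/-- The Chevalley-Eilenberg differential `C⁰(L, V) = V → C¹(L, V)`, `(d v)(y) = y · v`. -/
def d₀₁ : V →ₗ[R] LieModule.Cohomology.oneCochain R L V :=
  (LieModule.toEnd R L V : L →ₗ[R] Module.End R V).flip

/-- The 1-cocycles `Z¹(L, V)`: the kernel of `(d f)(y, z) = y · f(z) - z · f(y) - f([y, z])`. -/
def Z1 : Submodule R (LieModule.Cohomology.oneCochain R L V) :=
  LinearMap.ker (LieModule.Cohomology.d₁₂ R L V)

/-- The 1-coboundaries `B¹(L, V)`. -/
def B1 : Submodule R (LieModule.Cohomology.oneCochain R L V) :=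
  LinearMap.range (d₀₁ R L V)

theorem B1_le_Z1 : B1 R L V ≤ Z1 R L V := by
  rintro _ ⟨v, rfl⟩
  rw [Z1, LinearMap.mem_ker]
  ext y z
  simp [d₀₁]

/-- The first Chevalley-Eilenberg cohomology `H¹(L, V) = Z¹(L, V) / B¹(L, V)`. -/
abbrev H1 : Type _ := Z1 R L V ⧸ (B1 R L V).submoduleOf (Z1 R L V)

end Cohomology

end Melikian

end

/-!
A derivation `δ` is reduced, by subtracting inner derivations, to one killing `D₁`, `D₂` and the
Euler field. In characteristic `5` the relation `(ad Dᵢ)⁵ = 0` makes `(ad Dᵢ)⁴ (δ Dᵢ)` central,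
hence zero, and this is exactly the condition under which the closed pair `(δ D₁, δ D₂)` is
`(⁅D₁, m⁆, ⁅D₂, m⁆)` for some `m`. A reduced `δ` commutes with the `Dᵢ` and preserves degrees
modulo `5`. If it kills all `(Dⱼ f) Dᵢ~`, its value at `f Dᵢ~` therefore has constant
coordinates, and then vanishes unless the degree of `f` is `0` or `1` modulo `5`. Moreover the `f`
for which `δ` kills every `f Dᵢ~` include `Dᵢ(gh)` along with `g` and `h`. Taking `h = xᵢ²`, this
second principle produces by induction all monomials with an exponent `1`, `2` or `3`, and the
others have degree `0`, `4` or `8`. The fields `f Dᵢ~` generate `M`.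
-/

noncomputable section

namespace Melikian

section LieDerivation

attribute [local instance] LieRing.ofAssociativeRing

variable {R L : Type*} [CommRing R] [LieRing L] [LieAlgebra R L]

theorem apply_lie_of_apply_eq_zero {δ : LieDerivation R L L} {d : L} (hd : δ d = 0) (y : L) :
    δ ⁅d, y⁆ = ⁅d, δ y⁆ := by
  rw [LieDerivation.apply_lie_eq_add, hd, zero_lie, add_zero]

theorem add_ad_apply (δ : LieDerivation R L L) (m y : L) :
    (δ + LieDerivation.ad R L m) y = δ y - ⁅y, m⁆ := by
  rw [LieDerivation.add_apply, LieDerivation.ad_apply_apply, ← lie_skew, sub_eq_add_neg]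

theorem ad_pow_char (p : ℕ) [Fact p.Prime] [CharP R p] {B : Type*} [Ring B] [Algebra R B]
    (b : B) : LieAlgebra.ad R B b ^ p = LieAlgebra.ad R B (b ^ p) := by
  have hp : (p : Module.End R B) = 0 := by
    rw [← map_natCast (algebraMap R (Module.End R B)), CharP.cast_eq_zero, map_zero]
  have hcomm : Commute (LinearMap.mulLeft R b - LinearMap.mulRight R b)
      (LinearMap.mulRight R b) :=
    (LinearMap.commute_mulLeft_right b b).sub_left (Commute.refl _)
  obtain ⟨r, hr⟩ := hcomm.exists_add_pow_prime_eq (Fact.out : p.Prime)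
  rw [sub_add_cancel, hp, zero_mul, zero_mul, zero_mul, add_zero, ← sub_eq_iff_eq_add] at hr
  ext z
  simp [LieAlgebra.ad_eq_lmul_left_sub_lmul_right, ← hr]

theorem ad_ad_pow_apply_ad (d z : L) (n : ℕ) :
    (LieAlgebra.ad R (Module.End R L) (LieAlgebra.ad R L d) ^ n) (LieAlgebra.ad R L z) =
      LieAlgebra.ad R L ((LieAlgebra.ad R L d ^ n) z) := by
  induction n with
  | zero => simp
  | succ n ih =>
    simp only [pow_succ', Module.End.mul_apply, ih, LieAlgebra.ad_apply, LieHom.map_lie]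

/-- Comparing `(ad (ad d)) ^ p δ = ⁅(ad d) ^ p, δ⁆` with `⁅ad d, δ⁆ = -ad (δ d)`. -/
theorem ad_pow_ad_apply_eq_zero (p : ℕ) [Fact p.Prime] [CharP R p] {d : L}
    (hd : LieAlgebra.ad R L d ^ p = 0) (δ : LieDerivation R L L) :
    LieAlgebra.ad R L ((LieAlgebra.ad R L d ^ (p - 1)) (δ d)) = 0 := by
  have hlie : ⁅LieAlgebra.ad R L d, (δ : Module.End R L)⁆ = -LieAlgebra.ad R L (δ d) := by
    ext y
    simp [LieRing.of_associative_ring_bracket]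
  have hpow := LinearMap.congr_fun (ad_pow_char p (R := R) (LieAlgebra.ad R L d))
    (δ : Module.End R L)
  rw [hd, map_zero, LinearMap.zero_apply, ← Nat.sub_one_add_one (Fact.out : p.Prime).ne_zero,
    pow_succ, Module.End.mul_apply, LieAlgebra.ad_apply, hlie, map_neg, ad_ad_pow_apply_ad,
    neg_eq_zero] at hpow
  exact hpow

theorem subsingleton_H1_iff :
    Subsingleton (H1 R L L) ↔ ∀ δ : LieDerivation R L L, ∃ m : L, ∀ y : L, δ y = ⁅m, y⁆ := by
  rw [Submodule.Quotient.subsingleton_iff, Submodule.submoduleOf_eq_top]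
  constructor
  · intro h δ
    have hδ : (δ : L →ₗ[R] L) ∈ Z1 R L L := by
      refine LinearMap.mem_ker.mpr ?_
      ext y z
      simp [LieModule.Cohomology.d₁₂_apply_apply]
    obtain ⟨v, hv⟩ := h hδ
    refine ⟨-v, fun y => ?_⟩
    rw [neg_lie, lie_skew]
    exact (LinearMap.congr_fun hv y).symm
  · intro h f hf
    have hf' (y z : L) : f ⁅y, z⁆ = ⁅y, f z⁆ - ⁅z, f y⁆ := by
      have := congrArg (fun g => g y z) (LinearMap.mem_ker.mp hf)
      rw [LieModule.Cohomology.d₁₂_apply_apply] at this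
      exact (sub_eq_zero.mp this).symm
    obtain ⟨m, hm⟩ := h ⟨f, hf'⟩
    refine ⟨-m, LinearMap.ext fun y => ?_⟩
    change ⁅y, -m⁆ = f y
    rw [lie_neg, lie_skew]
    exact (hm y).symm

end LieDerivation

section TruncatedPolynomials

variable {F : Type*} [Field F] [CharP F 5]

theorem two_ne_zero_of_charP_five : (2 : F) ≠ 0 := fun h =>
  one_ne_zero (α := F) (by linear_combination CharP.ofNat_eq_zero F 5 - 2 * h)

theorem D_apply_comm (i j : Fin 2) (f : A F) : D F i (D F j f) = D F j (D F i f) := by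
  fin_cases i <;> fin_cases j <;> first | rfl | exact D_comm F f | exact (D_comm F f).symm

theorem iterate_succ_D_mul_x (i j : Fin 2) (n : ℕ) (f : A F) :
    (D F i)^[n + 1] (f * x F j) =
      (D F i)^[n + 1] f * x F j + (n + 1) * D F i (x F j) * (D F i)^[n] f := by
  induction n with
  | zero =>
    simp only [zero_add, Function.iterate_one, Function.iterate_zero, id_eq, Derivation.leibniz,
      smul_eq_mul, Nat.cast_zero, one_mul]
    ring
  | succ n ih =>
    have hconst : D F i (((n : A F) + 1) * D F i (x F j)) = 0 := by
      have hnat : D F i ((n : A F) + 1) = 0 := mod_cast (D F i).map_natCast (n + 1)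
      rw [D_x]
      split <;> simp [hnat]
    rw [Function.iterate_succ_apply', ih, map_add, Derivation.leibniz, Derivation.leibniz, hconst]
    simp only [Function.iterate_succ_apply', smul_eq_mul, Nat.cast_succ, mul_zero, add_zero]
    ring

theorem iterate_five_D (i : Fin 2) (f : A F) : (D F i)^[5] f = 0 := by
  obtain ⟨f, rfl⟩ := mk_surjective F f
  induction f using MvPolynomial.induction_on with
  | C a =>
    rw [← MvPolynomial.algebraMap_eq, AlgHom.commutes, Function.iterate_succ_apply,
      Derivation.map_algebraMap, iterate_map_zero]
  | add p q hp hq => rw [map_add, iterate_map_add, hp, hq, add_zero]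
  | mul_X p j hp =>
    have hfive : ((4 : ℕ) : A F) + 1 = 0 := by linear_combination five_eq_zero F
    rw [map_mul, ← x, iterate_succ_D_mul_x, hp, hfive]
    ring

/-- An antiderivative of `f` in the `i`-th variable, valid when the fourth derivative of `f`
vanishes. It is what four integrations by parts produce: modulo `5`, the coefficients `1/2!`,
`1/3!` and `-1/4!` become `3`, `1` and `1`. -/
def primitive (i : Fin 2) (f : A F) : A F :=
  x F i * f - 3 * x F i ^ 2 * D F i f + x F i ^ 3 * (D F i)^[2] f + x F i ^ 4 * (D F i)^[3] f

theorem D_primitive {i : Fin 2} {f : A F} (hf : (D F i)^[4] f = 0) :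
    D F i (primitive i f) = f := by
  have hthree : D F i 3 = 0 := mod_cast (D F i).map_natCast 3
  simp only [Function.iterate_succ, Function.iterate_zero, Function.comp_apply, id_eq] at hf
  simp only [primitive, Function.iterate_succ, Function.iterate_zero, Function.comp_apply, id_eq,
    map_add, map_sub, Derivation.leibniz, Derivation.leibniz_pow, smul_eq_mul,
    D_x, if_true, hf, hthree, nsmul_eq_mul, mul_one, mul_zero]
  push_cast
  linear_combination
    (-x F i * D F i f + x F i ^ 3 * D F i (D F i (D F i f))) * five_eq_zero F

theorem D_primitive_of_ne {i j : Fin 2} (hij : i ≠ j) (f : A F) :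
    D F i (primitive j f) = primitive j (D F i f) := by
  have hthree : D F i 3 = 0 := mod_cast (D F i).map_natCast 3
  simp only [primitive, map_add, map_sub, Derivation.leibniz, Derivation.leibniz_pow, smul_eq_mul,
    D_x, hij, if_false, hthree, mul_zero, smul_zero, add_zero, Function.iterate_succ,
    Function.iterate_zero, Function.comp_apply, id_eq, D_apply_comm i j]

theorem exists_D_eq {p : Fin 2 → A F} (hp : ∀ i, (D F i)^[4] (p i) = 0)
    (hclosed : D F 0 (p 1) = D F 1 (p 0)) : ∃ r : A F, ∀ i, D F i r = p i := by
  set q := p 1 - D F 1 (primitive 0 (p 0)) with hq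
  have hq₀ : D F 0 q = 0 := by
    rw [hq, map_sub, D_apply_comm 0 1, D_primitive (hp 0), hclosed, sub_self]
  have hq₁ : (D F 1)^[4] q = 0 := by
    rw [hq, iterate_map_sub, hp, ← Function.iterate_succ_apply, iterate_five_D, sub_zero]
  refine ⟨primitive 0 (p 0) + primitive 1 q, Fin.forall_fin_two.mpr ⟨?_, ?_⟩⟩
  · rw [map_add, D_primitive (hp 0), D_primitive_of_ne zero_ne_one, hq₀]
    simp [primitive]
  · rw [map_add, D_primitive hq₁, hq, add_sub_cancel]

end TruncatedPolynomials

section VectorFields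

variable {F : Type*} [Field F] [CharP F 5]

theorem eq_sum_smul_D (E : W F) : E = ∑ i, E (x F i) • D F i := by
  refine W_ext F fun i => ?_
  fin_cases i <;> simp [D_x]

theorem lie_D_apply_x (i j : Fin 2) (G : W F) : ⁅D F i, G⁆ (x F j) = D F i (G (x F j)) := by
  rw [Derivation.commutator_apply, D_x]
  split <;> simp

theorem D_lie_smul_D (i j : Fin 2) (f : A F) : ⁅D F i, f • D F j⁆ = D F i f • D F j := by
  ext g
  simp [Derivation.commutator_apply, D_apply_comm i j]

theorem D_lie_D (i j : Fin 2) : ⁅D F i, D F j⁆ = 0 := by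
  simpa using D_lie_smul_D i j 1

theorem smul_D_lie (f : A F) (i : Fin 2) (G : W F) :
    ⁅f • D F i, G⁆ = f • ⁅D F i, G⁆ - G f • D F i := by
  ext g
  simp only [Derivation.commutator_apply, Derivation.sub_apply, Derivation.smul_apply,
    Derivation.leibniz, smul_eq_mul]
  ring

theorem div_smul_D (f : A F) (i : Fin 2) : div F (f • D F i) = D F i f := by
  fin_cases i <;> simp [div, D_x]

theorem div_D (i : Fin 2) : div F (D F i) = 0 := by
  simpa using div_smul_D (1 : A F) i

theorem div_eq_zero_of_lie_D_eq_zero {G : W F} (hG : ∀ i, ⁅D F i, G⁆ = 0) : div F G = 0 := by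
  simp [div, ← lie_D_apply_x, hG]

/-- The Euler field `x₁D₁ + x₂D₂`; the adjoint action of its copy in `W(2) ⊆ M` on homogeneous
elements records their degree modulo `5`. -/
def euler (F : Type*) [Field F] [CharP F 5] : W F := ∑ i, x F i • D F i

theorem euler_apply (f : A F) : euler F f = ∑ i, x F i * D F i f := by
  simp [euler]

theorem div_euler : div F (euler F) = 2 := by
  simp [div, euler_apply, D_x, one_add_one_eq_two]

theorem lie_D_euler (i : Fin 2) : ⁅D F i, euler F⁆ = D F i := by
  refine W_ext F fun j => ?_
  rw [lie_D_apply_x]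
  fin_cases i <;> fin_cases j <;> simp [euler_apply, D_x]

theorem euler_lie (G : W F) : ⁅euler F, G⁆ = ∑ i, x F i • ⁅D F i, G⁆ - G := by
  conv_rhs => rw [eq_sum_smul_D G]
  simp only [euler, sum_lie, smul_D_lie, Finset.sum_sub_distrib]
  simp [← eq_sum_smul_D G]

end VectorFields

section Monomials

theorem mk_monomial_eq_zero {F : Type*} [Field F] {s : Fin 2 →₀ ℕ} {i : Fin 2} (hs : 5 ≤ s i)
    (c : F) : mk F (MvPolynomial.monomial s c) = 0 := by
  have hle : Finsupp.single i 5 ≤ s := Finsupp.single_le_iff.mpr hs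
  refine (mk_eq_zero F _).mpr ?_
  rw [← tsub_add_cancel_of_le hle, ← mul_one c, ← MvPolynomial.monomial_mul,
    ← MvPolynomial.X_pow_eq_monomial]
  exact Ideal.mul_mem_left _ _ (Ideal.subset_span ⟨i, rfl⟩)

variable {F : Type*} [Field F] [CharP F 5]

theorem D_mk_monomial (i : Fin 2) (s : Fin 2 →₀ ℕ) :
    D F i (mk F (MvPolynomial.monomial s 1)) =
      (s i : F) • mk F (MvPolynomial.monomial (s - Finsupp.single i 1) 1) := by
  rw [D_mk, MvPolynomial.pderiv_monomial, ← map_smul, MvPolynomial.smul_monomial, smul_eq_mul,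
    mul_comm]

theorem euler_mk {φ : MvPolynomial (Fin 2) F} {n : ℕ} (hφ : φ.IsHomogeneous n) :
    euler F (mk F φ) = (n : F) • mk F φ := by
  rw [euler_apply]
  simp only [D_mk, x, ← map_mul, ← map_sum, hφ.sum_X_mul_pderiv]
  rw [map_nsmul, Nat.cast_smul_eq_nsmul]

theorem D_x_sq_mul_mk_monomial (i : Fin 2) (t : Fin 2 →₀ ℕ) :
    D F i (x F i ^ 2 * mk F (MvPolynomial.monomial t 1)) =
      (t i + 2 : F) • mk F (MvPolynomial.monomial (t + Finsupp.single i 1) 1) := by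
  have hexp : Finsupp.single i 2 + t - Finsupp.single i 1 = t + Finsupp.single i 1 := by
    rw [Finsupp.single_add i 1 1, add_assoc, add_tsub_cancel_left, add_comm]
  rw [x, ← map_pow, ← map_mul, MvPolynomial.X_pow_eq_monomial, MvPolynomial.monomial_mul,
    mul_one, D_mk_monomial, hexp, Finsupp.add_apply, Finsupp.single_eq_same, Nat.cast_add,
    Nat.cast_ofNat, add_comm (2 : F)]

end Monomials

section Components

variable {F : Type*} [Field F]

/-- The inclusion of the summand `A(2)` in `M`. -/
def ofA : A F →ₗ[F] M F where
  toFun f := ⟨f, 0, 0⟩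
  map_add' _ _ := M.ext rfl (add_zero 0).symm (add_zero 0).symm
  map_smul' c _ := M.ext rfl (smul_zero c).symm (smul_zero c).symm

/-- The inclusion of the summand `W(2)` in `M`. -/
def ofW : W F →ₗ[F] M F where
  toFun E := ⟨0, E, 0⟩
  map_add' _ _ := M.ext (add_zero 0).symm rfl (add_zero 0).symm
  map_smul' c _ := M.ext (smul_zero c).symm rfl (smul_zero c).symm

/-- The inclusion `G ↦ G~` of the copy of `W(2)` in `M`. -/
def ofTilde : W F →ₗ[F] M F where
  toFun G := ⟨0, 0, G⟩
  map_add' _ _ := M.ext (add_zero 0).symm (add_zero 0).symm rfl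
  map_smul' c _ := M.ext (smul_zero c).symm (smul_zero c).symm rfl

theorem eq_ofA_add_ofW_add_ofTilde (a : M F) : a = ofA a.fn + ofW a.vf + ofTilde a.tvf := by
  refine M.ext ?_ ?_ ?_
  · simp [ofA, ofW, ofTilde, add_1]
  · simp [ofA, ofW, ofTilde, add_2]
  · simp [ofA, ofW, ofTilde, add_3]

variable [CharP F 5]

theorem ofW_lie (E : W F) (a : M F) :
    ⁅ofW E, a⁆ = ⟨E a.fn - 2 * div F E * a.fn, ⁅E, a.vf⁆, ⁅E, a.tvf⁆ + (2 * div F E) • a.tvf⟩ := by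
  change bracket F _ _ = _
  ext <;> simp [bracket, ofW, div]

theorem ofW_lie_ofW (E G : W F) : ⁅ofW E, ofW G⁆ = ofW ⁅E, G⁆ := by
  rw [ofW_lie]
  simp [ofW]

theorem ofW_lie_ofTilde (E G : W F) :
    ⁅ofW E, ofTilde G⁆ = ofTilde (⁅E, G⁆ + (2 * div F E) • G) := by
  rw [ofW_lie]
  simp [ofTilde]

theorem ofW_D_lie (i : Fin 2) (a : M F) :
    ⁅ofW (D F i), a⁆ = ⟨D F i a.fn, ⁅D F i, a.vf⁆, ⁅D F i, a.tvf⁆⟩ := by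
  simp [ofW_lie, div_D]

theorem ofA_lie_ofTilde (f : A F) (G : W F) : ⁅ofA f, ofTilde G⁆ = ofW (f • G) := by
  change bracket F _ _ = _
  ext <;> simp [bracket, ofA, ofW, ofTilde, div]

theorem ofA_one_lie_ofTilde (G : W F) : ⁅ofA (1 : A F), ofTilde G⁆ = ofW G := by
  rw [ofA_lie_ofTilde, one_smul]

theorem ofTilde_lie_ofTilde (G G' : W F) :
    ⁅ofTilde G, ofTilde G'⁆ = ofA (G (x F 0) * G' (x F 1) - G (x F 1) * G' (x F 0)) := by
  change bracket F _ _ = _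
  ext <;> simp [bracket, ofA, ofTilde, div]

theorem ofTilde_lie_vf (G : W F) (a : M F) : ⁅ofTilde G, a⁆.vf = -(a.fn • G) := by
  change (bracket F _ _).vf = _
  ext
  simp [bracket, ofTilde]

theorem ofW_D_lie_ofTilde (i j : Fin 2) (f : A F) :
    ⁅ofW (D F i), ofTilde (f • D F j)⁆ = ofTilde (D F i f • D F j) := by
  rw [ofW_lie_ofTilde, D_lie_smul_D, div_D, mul_zero, zero_smul, add_zero]

theorem ofW_euler_lie_ofTilde {f : A F} {c : F} (hf : euler F f = c • f) (i : Fin 2) :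
    ⁅ofW (euler F), ofTilde (f • D F i)⁆ = (c + 3) • ofTilde (f • D F i) := by
  have hlie : ⁅euler F, f • D F i⁆ = (c - 1) • f • D F i := by
    rw [euler_lie]
    simp only [D_lie_smul_D, smul_smul, ← Finset.sum_smul, ← euler_apply, hf]
    rw [sub_smul, one_smul, smul_assoc]
  rw [ofW_lie_ofTilde, hlie, div_euler, ← map_smul]
  congr 1
  ext g
  simp only [Derivation.add_apply, Derivation.smul_apply, smul_eq_mul, Algebra.smul_def, map_add,
    map_sub, map_one, map_ofNat]
  ring

theorem ofW_x_smul_D_lie_ofTilde_x_smul_D (i j : Fin 2) :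
    ⁅ofW (x F i • D F i), ofTilde (x F j • D F i)⁆ =
      (if i = j then 2 else 1 : F) • ofTilde (x F j • D F i) := by
  rw [ofW_lie_ofTilde, smul_D_lie, D_lie_smul_D, div_smul_D, ← map_smul]
  simp only [D_x, Derivation.smul_apply, smul_eq_mul]
  congr 1
  ext g
  split_ifs with hij
  · subst hij
    simp [Algebra.smul_def, map_ofNat]
  · simp only [zero_smul, smul_zero, mul_one, zero_sub, one_smul, Derivation.add_apply,
      Derivation.neg_apply, Derivation.smul_apply, smul_eq_mul]
    ring

theorem ofTilde_D_lie_ofTilde_D : ⁅ofTilde (D F 0), ofTilde (D F 1)⁆ = ofA 1 := by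
  simp [ofTilde_lie_ofTilde, D_x]

theorem ofTilde_D_mul_smul_D (f g : A F) (i j : Fin 2) :
    ofTilde (D F i (f * g) • D F j) =
      -(⁅ofW (f • D F j), ofTilde (g • D F i)⁆ + ⁅ofW (g • D F i), ofTilde (f • D F j)⁆ +
        (2 : F) • ⁅ofW (f • D F i), ofTilde (g • D F j)⁆) := by
  simp only [ofW_lie_ofTilde, ← map_add, ← map_smul, ← map_neg, div_smul_D, smul_D_lie,
    D_lie_smul_D]
  congr 1
  ext h
  simp only [Derivation.add_apply, Derivation.sub_apply, Derivation.neg_apply,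
    Derivation.smul_apply, Derivation.leibniz, smul_eq_mul, Algebra.smul_def, map_ofNat]
  linear_combination (f * D F i g + g * D F i f) * D F j h * five_eq_zero F

end Components

section Coordinates

variable {F : Type*} [Field F]

/-- The five `A(2)`-valued coordinates of an element of `M`: its `A(2)`-component and the
coefficients of its two vector fields along `D₁` and `D₂`. -/
def coord (k : Unit ⊕ Fin 2 ⊕ Fin 2) (a : M F) : A F :=
  match k with
  | .inl _ => a.fn
  | .inr (.inl i) => a.vf (x F i)
  | .inr (.inr i) => a.tvf (x F i)

theorem ext_coord {a b : M F} (h : ∀ k, coord k a = coord k b) : a = b :=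
  M_ext F (h (.inl ())) (fun i => h (.inr (.inl i))) (fun i => h (.inr (.inr i)))

variable [CharP F 5]

theorem exists_coord_eq (r : Unit ⊕ Fin 2 ⊕ Fin 2 → A F) : ∃ a : M F, ∀ k, coord k a = r k := by
  refine ⟨⟨r (.inl ()), ∑ i, r (.inr (.inl i)) • D F i, ∑ i, r (.inr (.inr i)) • D F i⟩, ?_⟩
  rintro (_ | i | i)
  · rfl
  all_goals fin_cases i <;> simp [coord, D_x]

theorem coord_ofW_D_lie (i : Fin 2) (a : M F) (k : Unit ⊕ Fin 2 ⊕ Fin 2) :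
    coord k ⁅ofW (D F i), a⁆ = D F i (coord k a) := by
  rcases k with _ | j | j <;> simp [coord, ofW_D_lie, lie_D_apply_x]

theorem coord_ad_pow_ofW_D (i : Fin 2) (n : ℕ) (a : M F) (k : Unit ⊕ Fin 2 ⊕ Fin 2) :
    coord k ((LieAlgebra.ad F (M F) (ofW (D F i)) ^ n) a) = (D F i)^[n] (coord k a) := by
  rw [Module.End.pow_apply]
  exact (Function.Semiconj.iterate_right (f := coord k) (fun b => coord_ofW_D_lie i b k) n) a

theorem ad_ofW_D_pow_five (i : Fin 2) : LieAlgebra.ad F (M F) (ofW (D F i)) ^ 5 = 0 := by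
  ext1 a
  refine ext_coord fun k => ?_
  rw [coord_ad_pow_ofW_D, iterate_five_D]
  rcases k with _ | j | j <;> rfl

end Coordinates

section Constants

variable {F : Type*} [Field F] [CharP F 5]

/-- An element of `M` commuting with `D₁` and `D₂`, that is, with constant coordinates. -/
def IsConstant (z : M F) : Prop := ∀ i, ⁅ofW (D F i), z⁆ = 0

theorem isConstant_iff {z : M F} : IsConstant z ↔
    ∀ i, D F i z.fn = 0 ∧ ⁅D F i, z.vf⁆ = 0 ∧ ⁅D F i, z.tvf⁆ = 0 :=
  forall_congr' fun i => by rw [ofW_D_lie, M.ext_iff]; rfl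

theorem IsConstant.ofW_euler_lie {z : M F} (hz : IsConstant z) :
    ⁅ofW (euler F), z⁆ = ⟨z.fn, -z.vf, (3 : F) • z.tvf⟩ := by
  simp only [isConstant_iff, forall_and] at hz
  obtain ⟨hfn, hvf, htvf⟩ := hz
  rw [Melikian.ofW_lie, div_euler, euler_apply, euler_lie, euler_lie]
  simp only [hfn, hvf, htvf, mul_zero, smul_zero, Finset.sum_const_zero, zero_sub]
  congr 1
  · linear_combination -z.fn * five_eq_zero F
  · ext f
    simp only [Derivation.add_apply, Derivation.neg_apply, Derivation.smul_apply, smul_eq_mul,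
      Algebra.smul_def, map_ofNat]
    ring

theorem IsConstant.fn_eq_zero {z : M F} (hz : IsConstant z) {c : F} (hc : c ≠ 1)
    (hweight : ⁅ofW (euler F), z⁆ = c • z) : z.fn = 0 := by
  have h : z.fn = c • z.fn := congrArg M.fn (hz.ofW_euler_lie.symm.trans hweight)
  by_contra hne
  exact hc (smul_left_injective F hne (by simpa using h.symm))

theorem IsConstant.vf_eq_zero {z : M F} (hz : IsConstant z) {c : F} (hc : c ≠ -1)
    (hweight : ⁅ofW (euler F), z⁆ = c • z) : z.vf = 0 := by
  have h : -z.vf = c • z.vf := congrArg M.vf (hz.ofW_euler_lie.symm.trans hweight)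
  by_contra hne
  exact hc (smul_left_injective F hne (by simpa using h.symm))

theorem IsConstant.tvf_eq_zero {z : M F} (hz : IsConstant z) {c : F} (hc : c ≠ 3)
    (hweight : ⁅ofW (euler F), z⁆ = c • z) : z.tvf = 0 := by
  have h : (3 : F) • z.tvf = c • z.tvf := congrArg M.tvf (hz.ofW_euler_lie.symm.trans hweight)
  by_contra hne
  exact hc (smul_left_injective F hne h.symm)

theorem IsConstant.exists_ofW_euler_lie_eq {z : M F} (hz : IsConstant z) :
    ∃ n : M F, IsConstant n ∧ ⁅ofW (euler F), n⁆ = z := by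
  have hn : IsConstant (⟨z.fn, -z.vf, (2 : F) • z.tvf⟩ : M F) := by
    simp only [isConstant_iff] at hz ⊢
    intro i
    obtain ⟨hfn, hvf, htvf⟩ := hz i
    exact ⟨hfn, by rw [lie_neg, hvf, neg_zero], by rw [lie_smul (2 : F), htvf, smul_zero]⟩
  refine ⟨_, hn, hn.ofW_euler_lie.trans (M.ext rfl (neg_neg _) ?_)⟩
  have hsix : (3 : F) * 2 = 1 := by linear_combination CharP.ofNat_eq_zero F 5
  simp only [smul_smul, hsix, one_smul]

theorem ad_injective : Function.Injective (LieAlgebra.ad F (M F)) := by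
  refine (injective_iff_map_eq_zero _).mpr fun z hz => ?_
  have hlie (y : M F) : ⁅y, z⁆ = 0 := by
    rw [← lie_skew, ← LieAlgebra.ad_apply F, hz, LinearMap.zero_apply, neg_zero]
  have hconst : IsConstant z := fun i => hlie _
  have hweight : ⁅ofW (euler F), z⁆ = (0 : F) • z := by rw [hlie, zero_smul]
  have hthree : (0 : F) ≠ 3 := fun h => two_ne_zero_of_charP_five (F := F) <| by
    linear_combination h + CharP.ofNat_eq_zero F 5
  exact M.ext (hconst.fn_eq_zero zero_ne_one hweight)
    (hconst.vf_eq_zero (neg_ne_zero.mpr one_ne_zero).symm hweight)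
    (hconst.tvf_eq_zero hthree hweight)

end Constants

section Normalization

variable {F : Type*} [Field F] [CharP F 5]

theorem exists_ofW_D_lie_eq {u : Fin 2 → M F}
    (hu : ∀ i, (LieAlgebra.ad F (M F) (ofW (D F i)) ^ 4) (u i) = 0)
    (hclosed : ⁅ofW (D F 0), u 1⁆ = ⁅ofW (D F 1), u 0⁆) :
    ∃ m : M F, ∀ i, ⁅ofW (D F i), m⁆ = u i := by
  have hcoord (k) : ∃ r, ∀ i, D F i r = coord k (u i) := by
    refine exists_D_eq (fun i => ?_) ?_
    · rw [← coord_ad_pow_ofW_D, hu]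
      rcases k with _ | j | j <;> rfl
    · rw [← coord_ofW_D_lie, hclosed, coord_ofW_D_lie]
  choose r hr using hcoord
  obtain ⟨m, hm⟩ := exists_coord_eq r
  exact ⟨m, fun i => ext_coord fun k => by rw [coord_ofW_D_lie, hm, hr]⟩

theorem exists_ofW_D_lie_eq_apply (δ : LieDerivation F (M F) (M F)) :
    ∃ m : M F, ∀ i, ⁅ofW (D F i), m⁆ = δ (ofW (D F i)) := by
  refine exists_ofW_D_lie_eq (fun i => ?_) ?_
  · have : Fact (Nat.Prime 5) := ⟨Nat.prime_five⟩
    exact ad_injective <|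
      (ad_pow_ad_apply_eq_zero 5 (ad_ofW_D_pow_five i) δ).trans (map_zero _).symm
  · have hcomm : ⁅ofW (D F 0), ofW (D F 1)⁆ = 0 := by rw [ofW_lie_ofW, D_lie_D, map_zero]
    rw [← sub_eq_zero, ← LieDerivation.apply_lie_eq_sub, hcomm, map_zero]

/-- A derivation of `M` killing `D₁`, `D₂` and the Euler field. -/
structure IsNormalized (δ : LieDerivation F (M F) (M F)) : Prop where
  apply_ofW_D (i : Fin 2) : δ (ofW (D F i)) = 0
  apply_ofW_euler : δ (ofW (euler F)) = 0

theorem IsNormalized.isConstant_apply {δ : LieDerivation F (M F) (M F)} (hδ : IsNormalized δ)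
    {y : M F} (hy : ∀ i, δ ⁅ofW (D F i), y⁆ = 0) : IsConstant (δ y) := fun i => by
  rw [← apply_lie_of_apply_eq_zero (hδ.apply_ofW_D i), hy]

theorem exists_isNormalized_add_ad (δ : LieDerivation F (M F) (M F)) :
    ∃ m : M F, IsNormalized (δ + LieDerivation.ad F (M F) m) := by
  obtain ⟨m, hm⟩ := exists_ofW_D_lie_eq_apply δ
  have hD (i : Fin 2) : (δ + LieDerivation.ad F (M F) m) (ofW (D F i)) = 0 := by
    rw [add_ad_apply, hm, sub_self]
  have hconst : IsConstant ((δ + LieDerivation.ad F (M F) m) (ofW (euler F))) := fun i => by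
    rw [← apply_lie_of_apply_eq_zero (hD i), ofW_lie_ofW, lie_D_euler, hD]
  obtain ⟨n, hn, hne⟩ := hconst.exists_ofW_euler_lie_eq
  refine ⟨m + n, fun i => ?_, ?_⟩
  · rw [map_add, ← add_assoc, add_ad_apply, hD, hn, sub_zero]
  · rw [map_add, ← add_assoc, add_ad_apply, hne, sub_self]

end Normalization

section Vanishing

variable {F : Type*} [Field F] [CharP F 5] {δ : LieDerivation F (M F) (M F)}

theorem IsNormalized.lie_euler_apply (hδ : IsNormalized δ) {y : M F} {c : F}
    (hy : ⁅ofW (euler F), y⁆ = c • y) : ⁅ofW (euler F), δ y⁆ = c • δ y := by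
  rw [← apply_lie_of_apply_eq_zero hδ.apply_ofW_euler, hy, map_smul]

theorem IsNormalized.exists_apply_ofA_one (hδ : IsNormalized δ) :
    ∃ α : A F, δ (ofA 1) = ofA α := by
  have hone : IsConstant (ofA (1 : A F)) := by simp [isConstant_iff, ofA]
  have hweight : ⁅ofW (euler F), ofA (1 : A F)⁆ = (1 : F) • ofA 1 := by
    rw [hone.ofW_euler_lie]
    simp [ofA]
  have hconst := hδ.isConstant_apply fun i => by rw [hone i, map_zero]
  replace hweight := hδ.lie_euler_apply hweight
  have hneg : (1 : F) ≠ -1 := fun h => two_ne_zero_of_charP_five (F := F) <| by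
    linear_combination h
  have hthree : (1 : F) ≠ 3 := fun h => two_ne_zero_of_charP_five (F := F) <| by
    linear_combination -h
  exact ⟨_, M.ext rfl (hconst.vf_eq_zero hneg hweight) (hconst.tvf_eq_zero hthree hweight)⟩

theorem IsNormalized.exists_apply_ofTilde_D (hδ : IsNormalized δ) (i : Fin 2) :
    ∃ G : W F, δ (ofTilde (D F i)) = ofTilde G := by
  have hconst := hδ.isConstant_apply (y := ofTilde (D F i)) fun j => by
    rw [ofW_lie_ofTilde, D_lie_D, div_D]
    simp
  have hweight : ⁅ofW (euler F), ofTilde (D F i)⁆ = (3 : F) • ofTilde (D F i) := by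
    simpa using ofW_euler_lie_ofTilde (c := (0 : F)) (f := (1 : A F)) (by simp) i
  replace hweight := hδ.lie_euler_apply hweight
  have hone : (3 : F) ≠ 1 := fun h => two_ne_zero_of_charP_five (F := F) <| by
    linear_combination h
  have hneg : (3 : F) ≠ -1 := fun h => two_ne_zero_of_charP_five (F := F) <| by
    linear_combination 3 * h - 2 * CharP.ofNat_eq_zero F 5
  exact ⟨_, M.ext (hconst.fn_eq_zero hone hweight) (hconst.vf_eq_zero hneg hweight) rfl⟩

/-- If `δ 1 = α`, then `⁅1, Dᵢ~⁆ = Dᵢ` forces `δ Dᵢ~ = -α Dᵢ~`, and `⁅D₁~, D₂~⁆ = 1` gives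
`α = -2α`. -/
theorem IsNormalized.apply_ofA_one (hδ : IsNormalized δ) : δ (ofA 1) = 0 := by
  obtain ⟨α, hα⟩ := hδ.exists_apply_ofA_one
  have hG (i : Fin 2) : δ (ofTilde (D F i)) = ofTilde (-α • D F i) := by
    obtain ⟨G, hG⟩ := hδ.exists_apply_ofTilde_D i
    have h := hδ.apply_ofW_D i
    rw [← ofA_one_lie_ofTilde, LieDerivation.apply_lie_eq_add, hα, hG, ofA_one_lie_ofTilde,
      ofA_lie_ofTilde, ← map_add] at h
    rw [hG, neg_smul, ← eq_neg_of_add_eq_zero_left (congrArg M.vf h)]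
  have h := congrArg δ (ofTilde_D_lie_ofTilde_D (F := F))
  rw [LieDerivation.apply_lie_eq_add, hG, hG, hα, ofTilde_lie_ofTilde, ofTilde_lie_ofTilde,
    ← map_add] at h
  replace h := congrArg M.fn h
  simp only [ofA, LinearMap.coe_mk, AddHom.coe_mk, Derivation.smul_apply, D_x, smul_eq_mul, mul_one,
    mul_zero, zero_ne_one, one_ne_zero, if_true, if_false, one_mul, sub_zero] at h
  rw [hα, show α = 0 by linear_combination -2 * h - α * five_eq_zero F, map_zero]

theorem IsNormalized.apply_ofTilde_D (hδ : IsNormalized δ) (i : Fin 2) :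
    δ (ofTilde (D F i)) = 0 := by
  obtain ⟨G, hG⟩ := hδ.exists_apply_ofTilde_D i
  have h := hδ.apply_ofW_D i
  rw [← ofA_one_lie_ofTilde, apply_lie_of_apply_eq_zero hδ.apply_ofA_one, hG,
    ofA_one_lie_ofTilde] at h
  rw [hG, show G = 0 from congrArg M.vf h, map_zero]

/-- The functions `f` for which `δ` vanishes on `f D₁~` and `f D₂~`. -/
def tildeKernel (δ : LieDerivation F (M F) (M F)) : Submodule F (A F) where
  carrier := {f | ∀ i, δ (ofTilde (f • D F i)) = 0}
  add_mem' hf hg i := by rw [add_smul, map_add, map_add, hf i, hg i, add_zero]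
  zero_mem' i := by rw [zero_smul, map_zero, map_zero]
  smul_mem' c f hf i := by rw [smul_assoc, map_smul, map_smul, hf i, smul_zero]

theorem IsNormalized.one_mem_tildeKernel (hδ : IsNormalized δ) : (1 : A F) ∈ tildeKernel δ :=
  fun i => by rw [one_smul, hδ.apply_ofTilde_D]

theorem IsNormalized.apply_ofW (hδ : IsNormalized δ) (G : W F) :
    δ (ofW G) = ⁅ofA (1 : A F), δ (ofTilde G)⁆ := by
  rw [← apply_lie_of_apply_eq_zero hδ.apply_ofA_one, ofA_one_lie_ofTilde]

theorem IsNormalized.D_mul_mem_tildeKernel (hδ : IsNormalized δ) {f g : A F}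
    (hf : f ∈ tildeKernel δ) (hg : g ∈ tildeKernel δ) (i : Fin 2) :
    D F i (f * g) ∈ tildeKernel δ := fun j => by
  have hlie {f g : A F} (hf : f ∈ tildeKernel δ) (hg : g ∈ tildeKernel δ) (i j : Fin 2) :
      δ ⁅ofW (f • D F i), ofTilde (g • D F j)⁆ = 0 := by
    rw [LieDerivation.apply_lie_eq_add, hδ.apply_ofW, hf, hg]
    simp only [lie_zero, zero_lie, add_zero]
  rw [ofTilde_D_mul_smul_D, map_neg, map_add, map_add, map_smul δ, hlie hf hg, hlie hg hf,
    hlie hf hg, add_zero, smul_zero, add_zero, neg_zero]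

theorem IsNormalized.exists_apply_ofTilde_eq_ofW (hδ : IsNormalized δ) {f : A F}
    (hD : ∀ j, D F j f ∈ tildeKernel δ) {c : F} (hf : euler F f = c • f) (hc : c ≠ 0)
    (i : Fin 2) :
    ∃ P : W F, δ (ofTilde (f • D F i)) = ofW P ∧ (∀ k, ⁅D F k, P⁆ = 0) ∧ (c ≠ 1 → P = 0) := by
  set z := δ (ofTilde (f • D F i)) with hz
  have hconst : IsConstant z := hδ.isConstant_apply fun j => by
    rw [ofW_D_lie_ofTilde]
    exact hD j i
  have hweight : ⁅ofW (euler F), z⁆ = (c + 3) • z :=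
    hδ.lie_euler_apply (ofW_euler_lie_ofTilde hf i)
  have hfn : z.fn = 0 := by
    have h : ⁅ofTilde (D F i), z⁆ = 0 := by
      rw [← apply_lie_of_apply_eq_zero (hδ.apply_ofTilde_D i), ofTilde_lie_ofTilde]
      fin_cases i <;> simp [D_x]
    have h' := DFunLike.congr_fun (congrArg M.vf h) (x F i)
    rw [ofTilde_lie_vf] at h'
    simpa [D_x, zero_2] using h'
  have htvf : z.tvf = 0 := hconst.tvf_eq_zero (by simpa using hc) hweight
  refine ⟨z.vf, M.ext hfn rfl htvf, fun k => (isConstant_iff.mp hconst k).2.1, fun hc' =>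
    hconst.vf_eq_zero (fun h => hc' ?_) hweight⟩
  linear_combination h - CharP.ofNat_eq_zero F 5

theorem IsNormalized.mem_tildeKernel_of_euler (hδ : IsNormalized δ) {f : A F}
    (hD : ∀ j, D F j f ∈ tildeKernel δ) {c : F} (hf : euler F f = c • f) (hc₀ : c ≠ 0)
    (hc₁ : c ≠ 1) : f ∈ tildeKernel δ := fun i => by
  obtain ⟨P, hP, -, hP₀⟩ := hδ.exists_apply_ofTilde_eq_ofW hD hf hc₀ i
  rw [hP, hP₀ hc₁, map_zero]

theorem IsNormalized.exists_apply_ofTilde_x_smul_D (hδ : IsNormalized δ) (i j : Fin 2) :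
    ∃ P : W F, δ (ofTilde (x F j • D F i)) = ofW P ∧ ∀ k, ⁅D F k, P⁆ = 0 := by
  have hD (k : Fin 2) : D F k (x F j) ∈ tildeKernel δ := by
    rw [D_x]
    split
    · exact hδ.one_mem_tildeKernel
    · exact zero_mem _
  obtain ⟨P, hP, hconst, -⟩ := hδ.exists_apply_ofTilde_eq_ofW hD
    (c := 1) (by simp [euler_apply, D_x]) one_ne_zero i
  exact ⟨P, hP, hconst⟩

theorem IsNormalized.apply_ofW_x_smul_D (hδ : IsNormalized δ) (i j : Fin 2) :
    δ (ofW (x F j • D F i)) = 0 := by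
  obtain ⟨P, hP, hconst⟩ := hδ.exists_apply_ofTilde_x_smul_D i j
  rw [hδ.apply_ofW, hP, ← lie_skew, ofW_lie, div_eq_zero_of_lie_D_eq_zero hconst]
  simp only [ofA, LinearMap.coe_mk, AddHom.coe_mk, Derivation.map_one_eq_zero, mul_zero, mul_one,
    sub_self, lie_zero, smul_zero, add_zero, neg_eq_zero]
  rfl

/-- A constant field `P = δ (xⱼDᵢ~)` is a multiple of `Dᵢ`, because `xᵢDᵢ` acts on `xⱼDᵢ~` by a
nonzero scalar `c`; the multiple vanishes because `c ≠ -1`. -/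
theorem IsNormalized.x_mem_tildeKernel (hδ : IsNormalized δ) (j : Fin 2) :
    x F j ∈ tildeKernel δ := fun i => by
  obtain ⟨P, hP, hconst⟩ := hδ.exists_apply_ofTilde_x_smul_D i j
  have htwo := two_ne_zero_of_charP_five (F := F)
  obtain ⟨c, hc₀, hc₁, hc⟩ : ∃ c : F, c ≠ 0 ∧ c + 1 ≠ 0 ∧
      ⁅ofW (x F i • D F i), ofTilde (x F j • D F i)⁆ = c • ofTilde (x F j • D F i) := by
    refine ⟨_, ?_, fun h => htwo ?_, ofW_x_smul_D_lie_ofTilde_x_smul_D i j⟩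
    · split_ifs <;> simp [htwo]
    · split_ifs at h
      · linear_combination 4 * h - 2 * CharP.ofNat_eq_zero F 5
      · linear_combination h
  have hlie : -P (x F i) • D F i = c • P := by
    have h := apply_lie_of_apply_eq_zero (hδ.apply_ofW_x_smul_D i i) (ofTilde (x F j • D F i))
    rw [hc, map_smul, hP, ofW_lie_ofW, smul_D_lie, hconst, smul_zero, zero_sub, ← neg_smul] at h
    exact (congrArg M.vf h).symm
  have hPi : P (x F i) = 0 := by
    have h := DFunLike.congr_fun hlie (x F i)
    rw [Derivation.smul_apply, D_x, if_pos rfl, smul_eq_mul, mul_one, Derivation.smul_apply] at h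
    rw [← smul_eq_zero_iff_right hc₁, add_smul, ← h, one_smul, neg_add_cancel]
  rw [hPi, neg_zero, zero_smul, eq_comm, smul_eq_zero_iff_right hc₀] at hlie
  rw [hP, hlie, map_zero]

theorem IsNormalized.x_sq_mem_tildeKernel (hδ : IsNormalized δ) (j : Fin 2) :
    x F j ^ 2 ∈ tildeKernel δ := by
  have htwo := two_ne_zero_of_charP_five (F := F)
  refine hδ.mem_tildeKernel_of_euler (c := 2) (fun k => ?_) ?_ htwo fun h => htwo ?_
  · rw [Derivation.leibniz_pow, D_x]
    split
    · simpa using nsmul_mem (hδ.x_mem_tildeKernel j) 2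
    · simp
  · simp only [euler_apply, Derivation.leibniz_pow, Nat.add_one_sub_one, pow_one, D_x, smul_eq_mul,
      mul_ite, mul_one, mul_zero, Finset.sum_ite_eq', Finset.mem_univ, if_true,
      Algebra.smul_def, map_ofNat]
    ring
  · linear_combination 2 * h

theorem mk_monomial_add_single_mem_tildeKernel (hδ : IsNormalized δ) {i : Fin 2}
    {t : Fin 2 →₀ ℕ} (ht : mk F (MvPolynomial.monomial t 1) ∈ tildeKernel δ)
    (hti : ((t i + 2 : ℕ) : F) ≠ 0) :
    mk F (MvPolynomial.monomial (t + Finsupp.single i 1) 1) ∈ tildeKernel δ := by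
  have h := hδ.D_mul_mem_tildeKernel (hδ.x_sq_mem_tildeKernel i) ht i
  rw [D_x_sq_mul_mk_monomial] at h
  exact ((tildeKernel δ).smul_mem_iff (by simpa using hti)).mp h

theorem mk_monomial_mem_tildeKernel (hδ : IsNormalized δ) (s : Fin 2 →₀ ℕ) :
    mk F (MvPolynomial.monomial s 1) ∈ tildeKernel δ := by
  induction hn : s.degree using Nat.strong_induction_on generalizing s with
  | _ n ih =>
  subst hn
  have hpred (i : Fin 2) (hi : s i ≠ 0) :
      mk F (MvPolynomial.monomial (s - Finsupp.single i 1) 1) ∈ tildeKernel δ := by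
    refine ih _ ?_ _ rfl
    conv_rhs => rw [← Finsupp.sub_add_single_one_cancel hi]
    simp only [map_add, Finsupp.degree_single, Nat.lt_add_one]
  by_cases hmid : ∃ i, s i ≠ 0 ∧ s i ≠ 4
  · obtain ⟨i, hi₀, hi₄⟩ := hmid
    by_cases hi₅ : 5 ≤ s i
    · rw [mk_monomial_eq_zero hi₅]
      exact zero_mem _
    · rw [← Finsupp.sub_add_single_one_cancel hi₀]
      refine mk_monomial_add_single_mem_tildeKernel hδ (hpred i hi₀) fun h => ?_
      rw [CharP.cast_eq_zero_iff F 5, Finsupp.tsub_apply, Finsupp.single_eq_same] at h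
      omega
  push Not at hmid
  by_cases hs : s = 0
  · rw [hs, MvPolynomial.monomial_zero', map_one, map_one]
    exact hδ.one_mem_tildeKernel
  have hdeg : s.degree = 4 ∨ s.degree = 8 := by
    rw [Finsupp.degree_eq_sum, Fin.sum_univ_two]
    have hne : ¬ (s 0 = 0 ∧ s 1 = 0) := fun h => hs (Finsupp.ext (Fin.forall_fin_two.mpr h))
    have h₀ := hmid 0
    have h₁ := hmid 1
    omega
  refine hδ.mem_tildeKernel_of_euler (fun j => ?_)
    (euler_mk (MvPolynomial.isHomogeneous_monomial 1 rfl)) ?_ ?_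
  · rw [D_mk_monomial]
    by_cases hj : s j = 0
    · simp only [hj, Nat.cast_zero, zero_smul, zero_mem]
    · exact (tildeKernel δ).smul_mem _ (hpred j hj)
  · rw [Ne, CharP.cast_eq_zero_iff F 5]
    omega
  · rw [← Nat.cast_one, Ne, CharP.natCast_eq_natCast F 5]
    rcases hdeg with h | h <;> rw [h] <;> decide

theorem IsNormalized.tildeKernel_eq_top (hδ : IsNormalized δ) : tildeKernel δ = ⊤ := by
  refine Submodule.eq_top_iff'.mpr fun f => ?_
  obtain ⟨f, rfl⟩ := mk_surjective F f
  induction f using MvPolynomial.induction_on' with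
  | monomial s c =>
    rw [← mul_one c, ← smul_eq_mul, ← MvPolynomial.smul_monomial, map_smul]
    exact (tildeKernel δ).smul_mem c (mk_monomial_mem_tildeKernel hδ s)
  | add p q hp hq =>
    rw [map_add]
    exact add_mem hp hq

theorem IsNormalized.apply_ofTilde (hδ : IsNormalized δ) (G : W F) : δ (ofTilde G) = 0 := by
  rw [eq_sum_smul_D G, map_sum, map_sum]
  refine Finset.sum_eq_zero fun i _ => ?_
  have hmem : G (x F i) ∈ tildeKernel δ := hδ.tildeKernel_eq_top ▸ Submodule.mem_top
  exact hmem i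

theorem IsNormalized.apply_eq_zero (hδ : IsNormalized δ) (y : M F) : δ y = 0 := by
  have hfn (f : A F) : δ (ofA f) = 0 := by
    have hf : ofA f = ⁅ofTilde (D F 0), ofTilde (f • D F 1)⁆ := by
      simp [ofTilde_lie_ofTilde, D_x]
    rw [hf, apply_lie_of_apply_eq_zero (hδ.apply_ofTilde _), hδ.apply_ofTilde, lie_zero]
  rw [eq_ofA_add_ofW_add_ofTilde y, map_add, map_add, hfn, hδ.apply_ofW, hδ.apply_ofTilde,
    hδ.apply_ofTilde, lie_zero, add_zero, add_zero]

theorem exists_apply_eq_lie (δ : LieDerivation F (M F) (M F)) :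
    ∃ m : M F, ∀ y : M F, δ y = ⁅m, y⁆ := by
  obtain ⟨m, hm⟩ := exists_isNormalized_add_ad δ
  refine ⟨-m, fun y => ?_⟩
  have h := hm.apply_eq_zero y
  rw [add_ad_apply, sub_eq_zero] at h
  rw [h, neg_lie, lie_skew]

end Vanishing

end Melikian

end

theorem mainTheorem2 (F : Type*) [Field F] [CharP F 5] :
    Subsingleton (Melikian.H1 F (Melikian.M F) (Melikian.M F)) ∧
      ∀ δ : LieDerivation F (Melikian.M F) (Melikian.M F),
        ∃ m : Melikian.M F, ∀ y : Melikian.M F, δ y = ⁅m, y⁆ :=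
  ⟨Melikian.subsingleton_H1_iff.mpr Melikian.exists_apply_eq_lie, Melikian.exists_apply_eq_lie⟩
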